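/- Let $H_n$, $n\ge 0$, be the Hermite polynomials, i.e. the polynomial eigenfunctions of $-\frac{d^2}{dx^2}+2x\frac{d}{dx}$ normalized by $H_n(x)=2^nx^n+\cdots$. For a finite set $F=\{f_1<\cdots<f_k\}$ of positive integers let $$\Omega_F(x)=\det\bigl(H_{f_i}^{(j-1)}(x)\bigr)_{i,j=1}^k$$ be the Wronskian of the polynomials $H_f$, $f\in F$, with $\Omega_\emptyset=1$. For $p\ge 1$ and $q\ge 1$ let $S(p,q)=\{p,p+1,\dots,p+q-1\}$, and let $S(p,0)=\emptyset$. Then for all integers $p\ge 1$ and $q\ge 1$: (A.1) the polynomials $\Omega_{S(p,q)}$ and $\Omega_{S(p+1,q-1)}$ have no common zeros in $\mathbb{C}$; (A.2) all complex zeros of $\Omega_{S(p,q)}$ are simple; (A.3) the polynomials $\Omega_{S(p,q)}$ and $\Omega_{S(p+1,q)}$ have no common zeros in $\mathbb{C}$. -/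

import Mathlib

open Polynomial

/-- The Hermite polynomials `H_n` in the physicists' normalization `H_n = 2 ^ n x ^ n + ⋯`, as
complex polynomials: `H_0 = 1` and `H_{n+1} = 2 x H_n - H_n'`. -/
noncomputable def hermiteH : ℕ → ℂ[X]
  | 0 => 1
  | n + 1 => 2 * X * hermiteH n - derivative (hermiteH n)

/-- `H_{n+1}' = 2 (n + 1) H_n`. -/
theorem derivative_hermiteH_succ (n : ℕ) :
    derivative (hermiteH (n + 1)) = 2 * ((n : ℂ[X]) + 1) * hermiteH n := by
  induction n with
  | zero => simp [hermiteH]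
  | succ n ih =>
    have h : hermiteH (n + 1) = 2 * X * hermiteH n - derivative (hermiteH n) := rfl
    rw [hermiteH, derivative_sub, ih]
    simp only [derivative_mul, derivative_X, derivative_ofNat, derivative_add, derivative_one,
      derivative_natCast]
    rw [ih]
    push_cast
    linear_combination (-2 * ((n : ℂ[X]) + 1)) * h

/-- `H_n` is an eigenfunction of `-d²/dx² + 2 x d/dx`, with eigenvalue `2 n`. -/
theorem hermiteH_eigen (n : ℕ) :
    -derivative (derivative (hermiteH n)) + 2 * X * derivative (hermiteH n)
      = 2 * (n : ℂ[X]) * hermiteH n := by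
  cases n with
  | zero => simp [hermiteH]
  | succ n =>
    have h : hermiteH (n + 1) = 2 * X * hermiteH n - derivative (hermiteH n) := rfl
    rw [derivative_hermiteH_succ]
    simp only [derivative_mul, derivative_ofNat, derivative_add, derivative_one,
      derivative_natCast]
    push_cast
    linear_combination (-2 * ((n : ℂ[X]) + 1)) * h

/-- `H_n` has degree `n` and leading coefficient `2 ^ n`. -/
theorem hermiteH_degree_leadingCoeff (n : ℕ) :
    (hermiteH n).degree = n ∧ (hermiteH n).leadingCoeff = 2 ^ n := by
  induction n with
  | zero => simp [hermiteH]
  | succ n ih =>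
    obtain ⟨hd, hl⟩ := ih
    have h2 : (2 * X : ℂ[X]) = C 2 * X := by rw [C_ofNat]
    have hX : (2 * X * hermiteH n).degree = ((n + 1 : ℕ) : WithBot ℕ) := by
      rw [h2, degree_mul, degree_C_mul_X (by norm_num), hd]
      push_cast
      exact add_comm _ _
    have hne : hermiteH n ≠ 0 := fun h => by simp [h] at hd
    have hlt : (derivative (hermiteH n)).degree < (2 * X * hermiteH n).degree := by
      refine (degree_derivative_lt hne).trans ?_
      rw [hX, hd]
      exact_mod_cast Nat.lt_succ_self n
    rw [hermiteH]
    refine ⟨(degree_sub_eq_left_of_degree_lt hlt).trans hX, ?_⟩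
    rw [leadingCoeff_sub_of_degree_lt hlt, leadingCoeff_mul, hl, h2, leadingCoeff_C_mul_X]
    ring

/-- The Wronskian `Ω_F = det (H_{f_i}^{(j-1)})_{i,j=1}^k` of a finite set `F = {f_1 < ⋯ < f_k}`;
it is `1` for the empty set. -/
noncomputable def hermiteWronskian (F : Finset ℕ) : ℂ[X] :=
  Matrix.det (Matrix.of fun i j : Fin F.card =>
    derivative^[(j : ℕ)] (hermiteH (F.orderEmbOfFin rfl i)))

/-- The segment `S(p, q) = {p, p + 1, …, p + q - 1}`; it is empty for `q = 0`. -/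
def segmentS (p q : ℕ) : Finset ℕ := Finset.Ico p (p + q)

/-! Any two of `Ω_{S(p+1,q-1)}`, `Ω_{S(p,q)}`, `Ω_{S(p+1,q)}` satisfy a Hirota bilinear equation
(`HirotaPair`). Its lowest-order term at `z` forces the multiplicities `m`, `n` there to satisfy `(m
- n)² = m + n`. Three numbers related pairwise in this way are all zero, or two are zero and the
third is one (`multiplicities_of_triangle`), which gives all three claims.

The Hirota equation comes from `hirotaPair_rowDet`: for a sequence of rows in which differentiation
moves each row to the next, up to a factor, the determinants of rows `0..n` and `1..n+1` are linked
by a three-term Plücker relation. Differentiation and the Hermite equation express its terms through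
derivatives of the two determinants. Removing an index and raising all indices by one are both
instances. Nonvanishing of the Wronskians, needed for multiplicities, is read off a Vandermonde top
coefficient. -/

theorem det_eq_sum_prod_row {n : ℕ} {R : Type*} [CommRing R] (M : Matrix (Fin n) (Fin n) R) :
    M.det = ∑ σ : Equiv.Perm (Fin n), ((Equiv.Perm.sign σ : ℤ) : R) * ∏ i, M i (σ i) := by
  rw [← Matrix.det_transpose, Matrix.det_apply']
  rfl

/-- A matrix determinant is differentiated row by row. -/
theorem derivative_det_eq_sum_updateRow {n : ℕ} (M : Matrix (Fin n) (Fin n) ℂ[X]) :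
    derivative M.det = ∑ k, (M.updateRow k fun i => derivative (M k i)).det := by
  simp only [det_eq_sum_prod_row]
  rw [Finset.sum_comm, derivative_sum]
  refine Finset.sum_congr rfl fun σ _ => ?_
  rw [← Finset.mul_sum, derivative_intCast_mul, derivative_prod_finset]
  congr 1
  refine Finset.sum_congr rfl fun k _ => ?_
  rw [← Finset.prod_erase_mul _ _ (Finset.mem_univ k), Matrix.updateRow_self]
  congr 1
  refine Finset.prod_congr rfl fun j hj => ?_
  rw [Matrix.updateRow_ne (Finset.ne_of_mem_erase hj)]

/-- The infinitesimal action of a diagonal matrix on a determinant is through its trace. -/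
theorem sum_det_updateRow_diagonal_mul {n : ℕ} {R : Type*} [CommRing R]
    (M : Matrix (Fin n) (Fin n) R) (d : Fin n → R) :
    ∑ k, (M.updateRow k fun i => d i * M k i).det = (∑ i, d i) * M.det := by
  simp only [det_eq_sum_prod_row]
  rw [Finset.sum_comm, Finset.mul_sum]
  refine Finset.sum_congr rfl fun σ _ => ?_
  rw [← Finset.mul_sum, mul_left_comm]
  congr 1
  rw [← Equiv.sum_comp σ d, Finset.sum_mul]
  refine Finset.sum_congr rfl fun k _ => ?_
  rw [← Finset.prod_erase_mul _ _ (Finset.mem_univ k), Matrix.updateRow_self,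
    ← Finset.prod_erase_mul _ (fun i => M i (σ i)) (Finset.mem_univ k), mul_left_comm]
  congr 2
  refine Finset.prod_congr rfl fun j hj => ?_
  rw [Matrix.updateRow_ne (Finset.ne_of_mem_erase hj)]

/-- The Plücker exchange relation: the row vector `t` is exchanged with the rows of `M`. -/
theorem det_mul_det_updateRow {n : ℕ} {R : Type*} [CommRing R]
    (M N : Matrix (Fin n) (Fin n) R) (l : Fin n) (t : Fin n → R) :
    M.det * (N.updateRow l t).det =
      ∑ k, (M.updateRow k t).det * (N.updateRow l (M k)).det := by
  have h : M.det • t = ∑ k, (M.updateRow k t).det • M k := by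
    rw [← Matrix.det_transpose M, ← Matrix.mulVec_cramer]
    ext i
    simp [Matrix.mulVec, dotProduct, Matrix.cramer_transpose_apply, mul_comm]
  rw [← Matrix.det_updateRow_smul, h]
  refine (Matrix.detRowAlternating.toMultilinearMap.map_update_sum Finset.univ l _ N).trans
    (Finset.sum_congr rfl fun k _ => ?_)
  exact Matrix.det_updateRow_smul N l _ (M k)

/-! ### Flows on determinants of listed rows -/

/-- The determinant whose rows are the members of the family `c` listed by `s`. -/
noncomputable def rowDet {n : ℕ} (c : ℕ → Fin n → ℂ[X]) (s : Fin n → ℕ) : ℂ[X] :=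
  Matrix.det (Matrix.of fun k => c (s k))

theorem rowDet_eq_zero {n : ℕ} (c : ℕ → Fin n → ℂ[X]) {s : Fin n → ℕ} {i j : Fin n} (hij : i ≠ j)
    (h : s i = s j) : rowDet c s = 0 :=
  Matrix.det_zero_of_row_eq hij (congrArg c h)

theorem rowDet_update {n : ℕ} (c : ℕ → Fin n → ℂ[X]) (s : Fin n → ℕ) (k : Fin n) (a : ℕ) :
    rowDet c (Function.update s k a) =
      ((Matrix.of fun k => c (s k)).updateRow k (c a)).det := by
  rw [rowDet]
  congr 1
  ext i j
  by_cases h : i = k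
  · subst h; simp
  · simp [h]

theorem rowDet_comp_swap {n : ℕ} (c : ℕ → Fin n → ℂ[X]) (s : Fin n → ℕ) {i j : Fin n}
    (hij : i ≠ j) : rowDet c (s ∘ Equiv.swap i j) = -rowDet c s :=
  Matrix.detRowAlternating.map_swap (fun k => c (s k)) hij

section Flow

variable {n : ℕ} {c : ℕ → Fin n → ℂ[X]} {ε κ : ℕ → ℂ[X]} {d : Fin n → ℂ[X]}

theorem derivative_rowDet (hder : ∀ j i, derivative (c j i) = ε j * c (j + 1) i) (s : Fin n → ℕ) :
    derivative (rowDet c s) = ∑ k, ε (s k) * rowDet c (Function.update s k (s k + 1)) := by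
  rw [rowDet, derivative_det_eq_sum_updateRow]
  refine Finset.sum_congr rfl fun k _ => ?_
  rw [rowDet_update, ← Matrix.det_updateRow_smul]
  congr 2
  ext1 i
  simp [hder]

/-- By `heig`, advancing a row by two is `2 X` times its derivative, plus the scalar `κ` of that
row, minus a diagonal operator `d` on the columns. Summed over the rows, the latter two contribute
traces. The weight `ε` is kept so that a constant row may be adjoined with `ε = 0`. -/
theorem sum_rowDet_update_add_two (hder : ∀ j i, derivative (c j i) = ε j * c (j + 1) i)
    (heig : ∀ j i, ε j * c (j + 2) i = 2 * X * (ε j * c (j + 1) i) + (κ j - d i) * c j i)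
    (s : Fin n → ℕ) :
    ∑ k, ε (s k) * rowDet c (Function.update s k (s k + 2)) =
      2 * X * derivative (rowDet c s) + (∑ k, κ (s k) - ∑ i, d i) * rowDet c s := by
  rw [sub_mul, rowDet, derivative_det_eq_sum_updateRow, ← sum_det_updateRow_diagonal_mul _ d,
    Finset.sum_mul, Finset.mul_sum, ← Finset.sum_sub_distrib, ← Finset.sum_add_distrib]
  refine Finset.sum_congr rfl fun k _ => ?_
  set M := Matrix.of fun k => c (s k) with hM
  have h : ε (s k) • c (s k + 2) =
      (2 * X : ℂ[X]) • (fun i => derivative (M k i)) + (κ (s k) • M k +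
        (-1 : ℂ[X]) • fun i => d i * M k i) := by
    ext1 i
    simp only [Pi.add_apply, Pi.smul_apply, smul_eq_mul, hM, Matrix.of_apply, hder, heig]
    ring
  rw [rowDet_update, ← Matrix.det_updateRow_smul, h, Matrix.det_updateRow_add,
    Matrix.det_updateRow_add, Matrix.det_updateRow_smul, Matrix.det_updateRow_smul,
    Matrix.det_updateRow_smul, Matrix.updateRow_eq_self]
  ring

end Flow

/-! ### Hirota pairs and multiplicities of zeros -/

/-- The Hirota bilinear equation of a pair of neighbouring polynomials. -/
def HirotaPair (A B : ℂ[X]) : Prop :=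
  ∃ K : ℂ[X], derivative (derivative A) * B - 2 * (derivative A * derivative B)
    + A * derivative (derivative B) + 2 * X * (derivative A * B - A * derivative B)
    + K * (A * B) = 0

/-- The Euler operator `(X - z) d/dx` preserves the order of vanishing, so the exponent `m - 1` and
the case `m = 0` need no separate care later. -/
theorem X_sub_C_mul_derivative_pow_mul (z : ℂ) (m : ℕ) (U : ℂ[X]) :
    (X - C z) * derivative ((X - C z) ^ m * U) =
      (X - C z) ^ m * ((m : ℂ[X]) * U + (X - C z) * derivative U) := by
  cases m with
  | zero => simp
  | succ m =>
    rw [derivative_mul, derivative_X_sub_C_pow, C_eq_natCast, Nat.add_sub_cancel, pow_succ]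
    ring

theorem X_sub_C_sq_mul_derivative_pow_mul (z : ℂ) (m : ℕ) (U : ℂ[X]) :
    ∃ V : ℂ[X], (X - C z) ^ 2 * derivative (derivative ((X - C z) ^ m * U)) =
      (X - C z) ^ m * ((m : ℂ[X]) * ((m : ℂ[X]) - 1) * U + (X - C z) * V) := by
  have h1 := X_sub_C_mul_derivative_pow_mul z m U
  have h2 := congrArg derivative h1
  rw [derivative_mul, derivative_sub, derivative_X, derivative_C] at h2
  have h3 := X_sub_C_mul_derivative_pow_mul z m ((m : ℂ[X]) * U + (X - C z) * derivative U)
  refine ⟨(m : ℂ[X]) * derivative U - derivative U +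
    derivative ((m : ℂ[X]) * U + (X - C z) * derivative U), ?_⟩
  linear_combination (X - C z) * h2 + h3 - h1

/-- The multiplicities of a point as a zero of a Hirota pair are consecutive triangular numbers,
or both vanish. -/
theorem HirotaPair.rootMultiplicity_sq {A B : ℂ[X]} (h : HirotaPair A B) (hA : A ≠ 0) (hB : B ≠ 0)
    (z : ℂ) : ((A.rootMultiplicity z : ℤ) - B.rootMultiplicity z) ^ 2 =
      A.rootMultiplicity z + B.rootMultiplicity z := by
  obtain ⟨K, h⟩ := h
  obtain ⟨U, hU, hUz⟩ := exists_eq_pow_rootMultiplicity_mul_and_not_dvd A hA z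
  obtain ⟨V, hV, hVz⟩ := exists_eq_pow_rootMultiplicity_mul_and_not_dvd B hB z
  generalize A.rootMultiplicity z = m at *
  generalize B.rootMultiplicity z = n at *
  rw [dvd_iff_isRoot, IsRoot.def] at hUz hVz
  obtain ⟨S, hS⟩ := X_sub_C_sq_mul_derivative_pow_mul z m U
  obtain ⟨T, hT⟩ := X_sub_C_sq_mul_derivative_pow_mul z n V
  have hS1 := X_sub_C_mul_derivative_pow_mul z m U
  have hT1 := X_sub_C_mul_derivative_pow_mul z n V
  rw [← hU] at hS hS1
  rw [← hV] at hT hT1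
  -- The Hirota equation times `(X - z)²`, with `(X - z)^(m + n)` taken out. The first-order and `K`
  -- terms retain a factor `X - z`, so at `z` only `(m(m-1) - 2mn + n(n-1)) U(z) V(z)` survives.
  have key : (X - C z) ^ (m + n) * (((m : ℂ[X]) * ((m : ℂ[X]) - 1) * U + (X - C z) * S) * V
      - 2 * (((m : ℂ[X]) * U + (X - C z) * derivative U) * ((n : ℂ[X]) * V + (X - C z) * derivative V))
      + U * ((n : ℂ[X]) * ((n : ℂ[X]) - 1) * V + (X - C z) * T)
      + (X - C z) * (2 * X * (((m : ℂ[X]) * U + (X - C z) * derivative U) * V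
        - U * ((n : ℂ[X]) * V + (X - C z) * derivative V)))
      + (X - C z) ^ 2 * (K * (U * V))) = 0 := by
    rw [pow_add]
    linear_combination (X - C z) ^ 2 * h - ((X - C z) ^ n * V) * hS - ((X - C z) ^ m * U) * hT
      + 2 * ((X - C z) * derivative A) * hT1
      + 2 * ((X - C z) ^ n * ((n : ℂ[X]) * V + (X - C z) * derivative V)) * hS1
      - 2 * X * (X - C z) * ((X - C z) ^ n * V) * hS1
      + 2 * X * (X - C z) * ((X - C z) ^ m * U) * hT1
      + (-(X - C z) ^ 2 * derivative (derivative A) + 2 * X * (-(X - C z) ^ 2 * derivative A)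
        - (X - C z) ^ 2 * K * A) * hV
      + (-(X - C z) ^ 2 * derivative (derivative B) + 2 * X * ((X - C z) ^ 2 * derivative B)
        - (X - C z) ^ 2 * K * ((X - C z) ^ n * V)) * hU
  have key2 := (mul_eq_zero.mp key).resolve_left (pow_ne_zero _ (X_sub_C_ne_zero z))
  have h0 := congrArg (eval z) key2
  simp only [eval_add, eval_sub, eval_mul, eval_pow, eval_X, eval_C, eval_natCast, eval_one,
    eval_ofNat, sub_self, eval_zero] at h0
  have h1 : ((m : ℂ) * (m - 1) - 2 * m * n + n * (n - 1)) * (U.eval z * V.eval z) = 0 := by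
    linear_combination h0
  have h2 := (mul_eq_zero.mp h1).resolve_right (mul_ne_zero hUz hVz)
  have h3 : (((m : ℤ) - n) ^ 2 : ℂ) = (m + n : ℤ) := by push_cast; linear_combination h2
  exact_mod_cast h3

/-- Differences of the relations factor. If no two of the numbers are equal, the three linear
factors vanish, yet they sum to `-3`. Two equal numbers must both be zero, and the third then
satisfies `x² = x`. -/
theorem multiplicities_of_triangle {l m n : ℕ} (hlm : ((l : ℤ) - m) ^ 2 = l + m)
    (hmn : ((m : ℤ) - n) ^ 2 = m + n) (hln : ((l : ℤ) - n) ^ 2 = l + n) :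
    (l = 0 ∨ m = 0) ∧ (m = 0 ∨ n = 0) ∧ m ≤ 1 := by
  have hx : ((l : ℤ) - m) * (l + m - 2 * n - 1) = 0 := by linear_combination hln - hmn
  have hy : ((m : ℤ) - n) * (m + n - 2 * l - 1) = 0 := by linear_combination hlm - hln
  have hz : ((n : ℤ) - l) * (n + l - 2 * m - 1) = 0 := by linear_combination hmn - hlm
  rcases mul_eq_zero.mp hx with hx | hx
  · rw [hx] at hlm
    omega
  rcases mul_eq_zero.mp hy with hy | hy
  · rw [hy] at hmn
    omega
  rcases mul_eq_zero.mp hz with hz | hz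
  · have h : (l : ℤ) - n = 0 := by omega
    rw [h] at hln
    obtain ⟨rfl, rfl⟩ : l = 0 ∧ n = 0 := by omega
    exact ⟨Or.inl rfl, Or.inr rfl, by push_cast at hlm; nlinarith⟩
  · omega

/-! ### The Hirota equation from the Plücker relation -/

section Hirota

variable {m : ℕ} {c : ℕ → Fin (m + 2) → ℂ[X]} {ε κ : ℕ → ℂ[X]} {d : Fin (m + 2) → ℂ[X]}

theorem rowDet_update_eq_zero {n : ℕ} (c : ℕ → Fin n → ℂ[X]) {s : Fin n → ℕ} {k l : Fin n} {a : ℕ}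
    (hkl : k ≠ l) (h : s l = a) : rowDet c (Function.update s k a) = 0 :=
  rowDet_eq_zero c hkl (by rw [Function.update_self, Function.update_of_ne hkl.symm, h])

/-- The derivative of a determinant with consecutive rows. -/
theorem derivative_rowDet_consecutive (hder : ∀ j i, derivative (c j i) = ε j * c (j + 1) i)
    (r : ℕ) :
    derivative (rowDet c fun k => k + r) =
      ε (m + 1 + r) *
        rowDet c (Function.update (fun k => k + r) (Fin.last (m + 1)) (m + 2 + r)) := by
  rw [derivative_rowDet hder, Fin.sum_univ_castSucc, Finset.sum_eq_zero, zero_add]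
  · simp only [Fin.val_last]
    congr 3
    omega
  · intro k _
    rw [rowDet_update_eq_zero c (l := k.succ) (Fin.castSucc_lt_succ).ne, mul_zero]
    simp
    omega

/-- The derivative of a determinant with consecutive rows, the last being advanced by one. -/
theorem derivative_rowDet_update_last (hder : ∀ j i, derivative (c j i) = ε j * c (j + 1) i)
    (r : ℕ) :
    derivative (rowDet c (Function.update (fun k => k + r) (Fin.last (m + 1)) (m + 2 + r))) =
      ε (m + r) * rowDet c (Function.update
        (Function.update (fun k => k + r) (Fin.last (m + 1)) (m + 2 + r))
          (Fin.last m).castSucc (m + 1 + r)) +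
      ε (m + 2 + r) *
        rowDet c (Function.update (fun k => k + r) (Fin.last (m + 1)) (m + 3 + r)) := by
  rw [derivative_rowDet hder, Fin.sum_univ_castSucc, Fin.sum_univ_castSucc, Finset.sum_eq_zero,
    zero_add]
  · rw [Function.update_self, Function.update_idem,
      Function.update_of_ne (Fin.castSucc_lt_last _).ne]
    simp only [Fin.val_castSucc, Fin.val_last]
    congr 4 <;> omega
  · intro k _
    rw [rowDet_update_eq_zero c (l := k.succ.castSucc), mul_zero]
    · simp [Fin.ext_iff]
    · rw [Function.update_of_ne (Fin.castSucc_lt_last _).ne,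
        Function.update_of_ne (Fin.castSucc_lt_last _).ne]
      simp
      omega

/-- The second flow of a determinant with consecutive rows. -/
theorem sum_rowDet_consecutive_update_add_two (r : ℕ) :
    ∑ k : Fin (m + 2), ε (k + r) *
        rowDet c (Function.update (fun k => k + r) k (k + r + 2)) =
      -(ε (m + r) * rowDet c (Function.update
        (Function.update (fun k => k + r) (Fin.last (m + 1)) (m + 2 + r))
          (Fin.last m).castSucc (m + 1 + r))) +
      ε (m + 1 + r) *
        rowDet c (Function.update (fun k => k + r) (Fin.last (m + 1)) (m + 3 + r)) := by
  rw [Fin.sum_univ_castSucc, Fin.sum_univ_castSucc, Finset.sum_eq_zero, zero_add]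
  -- The next-to-last row, advanced by two, overtakes the last one; sorting them costs the sign.
  -- Every earlier row collides with the row two places below it.
  · rw [← mul_neg, ← rowDet_comp_swap c _ (Fin.castSucc_lt_last (Fin.last m)).ne]
    simp only [Fin.val_castSucc, Fin.val_last]
    congr 4
    · ext k
      refine Fin.lastCases ?_ (fun k => Fin.lastCases ?_ (fun k => ?_) k) k
      · have := (Fin.castSucc_lt_last (Fin.last m)).ne'
        simp [this]
      · have := (Fin.castSucc_lt_last (Fin.last m)).ne'
        simp [this]
        omega
      · have h1 := (Fin.castSucc_lt_last k.castSucc).ne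
        have h2 : k.castSucc.castSucc ≠ (Fin.last m).castSucc := by
          simp [Fin.ext_iff, k.2.ne]
        simp [h1, h2, Equiv.swap_apply_of_ne_of_ne h2 h1]
    · omega
  · intro k _
    rw [rowDet_update_eq_zero c (l := k.succ.succ), mul_zero]
    · simp [Fin.ext_iff, add_assoc]
    · simp
      omega

/-- The three-term Plücker relation. -/
theorem rowDet_pluecker (c : ℕ → Fin (m + 2) → ℂ[X]) :
    (rowDet c fun k => k + 1) *
        rowDet c (Function.update (fun k => (k : ℕ)) (Fin.last (m + 1)) (m + 3)) =
      -((rowDet c (Function.update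
        (Function.update (fun k => k + 1) (Fin.last (m + 1)) (m + 3))
          (Fin.last m).castSucc (m + 2))) * rowDet c fun k => (k : ℕ)) +
      rowDet c (Function.update (fun k => k + 1) (Fin.last (m + 1)) (m + 3)) *
        rowDet c (Function.update (fun k => (k : ℕ)) (Fin.last (m + 1)) (m + 2)) := by
  have h := det_mul_det_updateRow (Matrix.of fun k : Fin (m + 2) => c (k + 1))
    (Matrix.of fun k : Fin (m + 2) => c k) (Fin.last (m + 1)) (c (m + 3))
  have h0 : ∀ k : Fin (m + 2), (Matrix.of fun k : Fin (m + 2) => c (k + 1)) k = c (k + 1) :=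
    fun _ => rfl
  simp only [h0] at h
  simp only [← rowDet_update c (fun k => (k : ℕ)), ← rowDet_update c (fun k => (k + 1 : ℕ))] at h
  refine h.trans ?_
  -- Only the last two rows of the first matrix survive the exchange: the others already occur among
  -- the unreplaced rows of the second.
  rw [Fin.sum_univ_castSucc, Fin.sum_univ_castSucc, Finset.sum_eq_zero, zero_add]
  · rw [← neg_mul, ← rowDet_comp_swap c _ (Fin.castSucc_lt_last (Fin.last m)).ne]
    simp only [Fin.val_castSucc, Fin.val_last]
    congr 3
    · ext k
      refine Fin.lastCases ?_ (fun k => Fin.lastCases ?_ (fun k => ?_) k) k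
      · have := (Fin.castSucc_lt_last (Fin.last m)).ne'
        simp [this]
      · have := (Fin.castSucc_lt_last (Fin.last m)).ne'
        simp [this]
      · have h1 := (Fin.castSucc_lt_last k.castSucc).ne
        have h2 : k.castSucc.castSucc ≠ (Fin.last m).castSucc := by
          simp [Fin.ext_iff, k.2.ne]
        simp [h1, h2, Equiv.swap_apply_of_ne_of_ne h2 h1]
    · exact Function.update_eq_self (Fin.last (m + 1)) (fun k : Fin (m + 2) => (k : ℕ))
  · intro k _
    rw [rowDet_update_eq_zero c (k := Fin.last (m + 1)) (l := k.succ.castSucc), mul_zero]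
    · exact (Fin.castSucc_lt_last _).ne'
    · simp

end Hirota

/-- Determinants with consecutive rows `0, …, n` and `1, …, n + 1` form a Hirota pair. -/
theorem hirotaPair_rowDet {n : ℕ} {c : ℕ → Fin (n + 1) → ℂ[X]} {ε κ : ℕ → ℂ[X]}
    {d : Fin (n + 1) → ℂ[X]}
    (hder : ∀ j i, derivative (c j i) = ε j * c (j + 1) i)
    (heig : ∀ j i, ε j * c (j + 2) i = 2 * X * (ε j * c (j + 1) i) + (κ j - d i) * c j i)
    (hε0 : derivative (ε 0) = 0) (hε : ∀ j, ε (j + 1) = 1) :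
    HirotaPair (rowDet c fun k => (k : ℕ)) (rowDet c fun k => k + 1) := by
  have hA := sum_rowDet_update_add_two hder heig fun k => (k : ℕ)
  have hB := sum_rowDet_update_add_two hder heig fun k => (k : ℕ) + 1
  generalize (∑ k : Fin (n + 1), κ k - ∑ i, d i) = a at hA
  generalize (∑ k : Fin (n + 1), κ (k + 1) - ∑ i, d i) = b at hB
  refine ⟨a - b, ?_⟩
  cases n with
  | zero =>
    have hc : ∀ s : Fin (0 + 1) → ℕ, rowDet c s = c (s 0) 0 :=
      fun s => Matrix.det_fin_one _
    have hs : ∀ g : Fin (0 + 1) → ℂ[X], ∑ k, g k = g 0 := Fin.sum_univ_one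
    simp only [hc, hder, hs, Function.update_self, derivative_mul, hε, hε0,
      Fin.val_zero, zero_add] at hA hB ⊢
    simp only [Nat.reduceAdd, derivative_one] at hA hB ⊢
    linear_combination c 0 0 * hB - c 1 0 * hA
  | succ m =>
    have h1 := derivative_rowDet_consecutive hder 0
    have h2 := derivative_rowDet_update_last hder 0
    have h3 := derivative_rowDet_consecutive hder 1
    have h4 := derivative_rowDet_update_last hder 1
    have hp := rowDet_pluecker c
    have h5 := sum_rowDet_consecutive_update_add_two (c := c) (ε := ε) 0
    have h6 := sum_rowDet_consecutive_update_add_two (c := c) (ε := ε) 1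
    simp only [add_zero, hε, one_mul] at h1 h2 h5
    simp only [hε, one_mul] at h3 h4 h6 hB
    rw [h5] at hA
    rw [h6] at hB
    rw [h1] at hA ⊢
    rw [h3] at hB ⊢
    rw [h2]
    simp only [add_assoc, Nat.reduceAdd] at *
    rw [h4]
    -- Write `A₁`, `A₂` for `A` with its last row advanced by one, two, and `A₁₁` with the last two
    -- rows each advanced by one; likewise for `B`. Then `A'' = ε_m A₁₁ + A₂`, while the second flow
    -- is `-ε_m A₁₁ + A₂`. Eliminating `A₁₁` for `A` (so `ε_m` drops out) and `B₂` for `B` leaves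
    -- twice the Plücker relation `A₂ B - A₁ B₁ + A B₁₁ = 0`.
    linear_combination (rowDet c fun k => (k : ℕ)) * hB - (rowDet c fun k => (k : ℕ) + 1) * hA
      + 2 * hp

/-! ### Hirota pairs of Hermite Wronskians -/

/-- The Wronskian of the Hermite polynomials `H_{f 0}, H_{f 1}, …`. -/
noncomputable def hermiteDet {n : ℕ} (f : Fin n → ℕ) : ℂ[X] :=
  Matrix.det (Matrix.of fun i j : Fin n => derivative^[(j : ℕ)] (hermiteH (f i)))

theorem hermiteWronskian_segmentS (p q : ℕ) :
    hermiteWronskian (segmentS p q) = hermiteDet fun i : Fin q => p + i := by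
  have h : ∀ (F : Finset ℕ) (n : ℕ) (hF : F.card = n),
      hermiteWronskian F = hermiteDet fun i : Fin n => F.orderEmbOfFin hF i := by
    rintro F _ rfl
    rfl
  have hc : (segmentS p q).card = q := by simp [segmentS]
  rw [h _ q hc]
  congr 1
  refine (Finset.orderEmbOfFin_unique hc (fun i => ?_) fun i j hij => ?_).symm
  · simp [segmentS]
  · simpa using hij

/-- Each differentiation of the Hermite equation adds `2` to the zeroth-order coefficient, from the
derivative of `2 X`. This is `heig` with `κ j = 2 j` and `d i = 2 f i`. -/
theorem iterate_derivative_hermiteH (n j : ℕ) :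
    derivative^[j + 2] (hermiteH n) = 2 * X * derivative^[j + 1] (hermiteH n)
      + (2 * (j : ℂ[X]) - 2 * (n : ℂ[X])) * derivative^[j] (hermiteH n) := by
  induction j with
  | zero =>
    have h := hermiteH_eigen n
    simp only [zero_add, Function.iterate_succ, Function.iterate_zero, Function.comp_apply, id]
    push_cast
    linear_combination -h
  | succ j ih =>
    have h := congrArg derivative ih
    simp only [derivative_mul, derivative_add, derivative_sub, derivative_X, derivative_ofNat,
      derivative_natCast, ← Function.iterate_succ_apply' (⇑derivative)] at h
    push_cast
    linear_combination h

theorem HirotaPair.of_C_mul_left {A B : ℂ[X]} {a : ℂ} (ha : a ≠ 0) (h : HirotaPair (C a * A) B) :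
    HirotaPair A B := by
  obtain ⟨K, h⟩ := h
  refine ⟨K, (mul_eq_zero.mp ?_).resolve_left (C_ne_zero.mpr ha)⟩
  simp only [derivative_C_mul] at h
  linear_combination h

theorem HirotaPair.of_C_mul_right {A B : ℂ[X]} {a : ℂ} (ha : a ≠ 0) (h : HirotaPair A (C a * B)) :
    HirotaPair A B := by
  obtain ⟨K, h⟩ := h
  refine ⟨K, (mul_eq_zero.mp ?_).resolve_left (C_ne_zero.mpr ha)⟩
  simp only [derivative_C_mul] at h
  linear_combination h

theorem rowDet_iterate_derivative {n : ℕ} (f : Fin n → ℕ) :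
    (rowDet (fun j i => derivative^[j] (hermiteH (f i))) fun k => (k : ℕ)) = hermiteDet f := by
  rw [rowDet, hermiteDet, ← Matrix.det_transpose]
  rfl

/-- Raising all the indices by one. -/
theorem hirotaPair_hermiteDet_add_one {n : ℕ} (f : Fin (n + 1) → ℕ) :
    HirotaPair (hermiteDet fun i => f i + 1) (hermiteDet f) := by
  have h := hirotaPair_rowDet (n := n) (c := fun j i => derivative^[j] (hermiteH (f i + 1)))
    (ε := fun _ => 1) (κ := fun j => 2 * j) (d := fun i => 2 * ((f i + 1 : ℕ) : ℂ[X]))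
    (fun j i => by rw [one_mul, Function.iterate_succ_apply'])
    (fun j i => by simpa using iterate_derivative_hermiteH (f i + 1) j) (by simp) (by simp)
  rw [rowDet_iterate_derivative] at h
  have h2 : (rowDet (fun j i => derivative^[j] (hermiteH (f i + 1))) fun k => (k : ℕ) + 1) =
      C (∏ i, (2 * ((f i : ℂ) + 1))) * hermiteDet f := by
    rw [map_prod, ← rowDet_iterate_derivative, rowDet, rowDet, ← Matrix.det_mul_row]
    congr 1
    ext1 k i
    rw [Matrix.of_apply, Matrix.of_apply, Matrix.of_apply, Function.iterate_succ_apply,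
      derivative_hermiteH_succ, ← iterate_derivative_C_mul]
    simp only [map_mul, map_add, map_natCast, map_one, C_ofNat]
  rw [h2] at h
  exact h.of_C_mul_right (Finset.prod_ne_zero_iff.mpr fun i _ =>
    mul_ne_zero two_ne_zero (Nat.cast_add_one_ne_zero _))

/-- Removing one index. -/
theorem hirotaPair_hermiteDet_succAbove {n : ℕ} (f : Fin (n + 1) → ℕ) (k : Fin (n + 1)) :
    HirotaPair (hermiteDet fun i => f (k.succAbove i)) (hermiteDet f) := by
  -- The `k`-th unit vector is put before the Wronskian rows, so expanding along it deletes index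
  -- `k`. It is constant, hence `ε 0 = 0`; and `κ 0 = d k` makes the eigenvalue relation hold for
  -- it.
  let c : ℕ → Fin (n + 1) → ℂ[X] := fun j i =>
    Nat.casesOn j (if i = k then 1 else 0) fun j => derivative^[j] (hermiteH (f i))
  have h := hirotaPair_rowDet (n := n) (c := c)
    (ε := fun j => Nat.casesOn j 0 fun _ => 1)
    (κ := fun j => Nat.casesOn j (2 * (f k : ℂ[X])) fun j => 2 * (j : ℂ[X]))
    (d := fun i => 2 * (f i : ℂ[X]))
    (fun j i => by
      cases j with
      | zero => by_cases hi : i = k <;> simp [c, hi]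
      | succ j => simp only [c, one_mul, Function.iterate_succ_apply'])
    (fun j i => by
      cases j with
      | zero => by_cases hi : i = k <;> simp [c, hi]
      | succ j => simpa [c] using iterate_derivative_hermiteH (f i) j) (by simp) (by simp)
  have hB : (rowDet c fun k => (k : ℕ) + 1) = hermiteDet f := rowDet_iterate_derivative f
  have hA : (rowDet c fun k => (k : ℕ)) =
      C ((-1) ^ (k : ℕ)) * hermiteDet fun i => f (k.succAbove i) := by
    rw [rowDet, Matrix.det_succ_row_zero, Finset.sum_eq_single k, ← rowDet_iterate_derivative]
    · simp [c, rowDet]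
      rfl
    · intro i _ hi
      simp [c, hi]
    · simp
  rw [hA, hB] at h
  exact h.of_C_mul_left (pow_ne_zero _ (by norm_num))

/-! ### Nonvanishing of the Wronskians -/

/-- The top coefficient of a determinant of polynomials of bounded degree. -/
theorem coeff_det_of_natDegree_le {n N : ℕ} {R : Type*} [CommRing R]
    (M : Matrix (Fin n) (Fin n) R[X]) (hM : ∀ i j, (M i j).natDegree ≤ N) :
    M.det.coeff (n * N) = (Matrix.of fun i j => (M i j).coeff N).det := by
  rw [Matrix.det_apply, Matrix.det_apply, finsetSum_coeff]
  refine Finset.sum_congr rfl fun σ _ => ?_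
  have h := coeff_prod_of_natDegree_le (s := Finset.univ) (fun i => M (σ i) i) N fun i _ => hM _ _
  rw [Finset.card_univ, Fintype.card_fin] at h
  rw [Units.smul_def, Units.smul_def, coeff_smul, h]
  rfl

theorem natDegree_X_pow_mul_iterate_derivative_le {P : ℂ[X]} {a : ℕ} (hP : P.natDegree ≤ a)
    (j : ℕ) : (X ^ j * derivative^[j] P).natDegree ≤ a := by
  by_cases hj : j ≤ a
  · refine natDegree_mul_le.trans ?_
    have := natDegree_iterate_derivative P j
    rw [natDegree_X_pow]
    omega
  · rw [iterate_derivative_eq_zero (by omega)]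
    simp

theorem coeff_X_pow_mul_iterate_derivative (P : ℂ[X]) (a j : ℕ) :
    (X ^ j * derivative^[j] P).coeff a = a.descFactorial j * P.coeff a := by
  rw [coeff_X_pow_mul']
  split_ifs with h
  · rw [coeff_iterate_derivative, Nat.sub_add_cancel h, nsmul_eq_mul]
  · rw [Nat.descFactorial_of_lt (by omega), Nat.cast_zero, zero_mul]

/-- The falling factorials are monic of degree `j`, so column operations turn this into the
Vandermonde determinant of distinct nodes. -/
theorem det_descFactorial_ne_zero {n : ℕ} {f : Fin n → ℕ} (hf : Function.Injective f) :
    (Matrix.of fun i j : Fin n => ((f i).descFactorial j : ℂ)).det ≠ 0 := by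
  have h := Matrix.det_eval_matrixOfPolynomials_eq_det_vandermonde (fun i => (f i : ℂ))
    (fun j => descPochhammer ℂ j) (fun j => descPochhammer_natDegree ℂ j)
    fun j => monic_descPochhammer ℂ j
  simp only [descPochhammer_eval_eq_descFactorial] at h
  rw [← h]
  exact Matrix.det_vandermonde_ne_zero_iff.mpr (Nat.cast_injective.comp hf)

/-- The Wronskian of distinct Hermite polynomials does not vanish identically. -/
theorem hermiteDet_ne_zero {n : ℕ} {f : Fin n → ℕ} (hf : Function.Injective f) :
    hermiteDet f ≠ 0 := by
  intro h0
  have hN : ∀ i, f i ≤ ∑ i, f i := fun i =>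
    Finset.single_le_sum (fun _ _ => Nat.zero_le _) (Finset.mem_univ i)
  generalize ∑ i, f i = N at hN
  -- Scaling rows and columns by powers of `X` brings every entry to degree at most `N`, so that the
  -- coefficient of `X^(n N)` in the determinant is the determinant of the `X^N` coefficients. Any
  -- common bound `N` of the indices would do.
  let M : Matrix (Fin n) (Fin n) ℂ[X] := Matrix.of fun i j =>
    X ^ (N - f i) * (X ^ (j : ℕ) * derivative^[(j : ℕ)] (hermiteH (f i)))
  have hMij : ∀ i j, M i j =
      X ^ (N - f i) * (X ^ (j : ℕ) * derivative^[(j : ℕ)] (hermiteH (f i))) := fun _ _ => rfl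
  have hM : M.det = 0 := by
    have h1 := Matrix.det_mul_column (fun i => (X : ℂ[X]) ^ (N - f i))
      (Matrix.of fun i j : Fin n => X ^ (j : ℕ) * derivative^[(j : ℕ)] (hermiteH (f i)))
    have h2 := Matrix.det_mul_row (fun j : Fin n => (X : ℂ[X]) ^ (j : ℕ))
      (Matrix.of fun i j : Fin n => derivative^[(j : ℕ)] (hermiteH (f i)))
    rw [hermiteDet] at h0
    rw [h0, mul_zero] at h2
    simp only [Matrix.of_apply] at h1 h2
    rw [h2, mul_zero] at h1
    exact h1
  have hdeg : ∀ i, (hermiteH (f i)).natDegree = f i := fun i =>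
    natDegree_eq_of_degree_eq_some (hermiteH_degree_leadingCoeff (f i)).1
  have hc := coeff_det_of_natDegree_le (N := N) M fun i j => by
    rw [hMij]
    refine natDegree_mul_le.trans ?_
    have := natDegree_X_pow_mul_iterate_derivative_le (hdeg i).le j
    have := hN i
    rw [natDegree_X_pow]
    omega
  have hcoeff : ∀ i j, (M i j).coeff N = 2 ^ f i * ((f i).descFactorial j : ℂ) := by
    intro i j
    have hl := (hermiteH_degree_leadingCoeff (f i)).2
    rw [leadingCoeff, hdeg] at hl
    rw [hMij, coeff_X_pow_mul', if_pos (Nat.sub_le _ _), Nat.sub_sub_self (hN i),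
      coeff_X_pow_mul_iterate_derivative, hl, mul_comm]
  simp only [hcoeff] at hc
  have h3 := Matrix.det_mul_column (fun i => (2 : ℂ) ^ f i)
    (Matrix.of fun i j : Fin n => ((f i).descFactorial j : ℂ))
  simp only [Matrix.of_apply] at h3
  rw [hM, coeff_zero, h3] at hc
  exact mul_ne_zero (Finset.prod_ne_zero_iff.mpr fun i _ => pow_ne_zero _ two_ne_zero)
    (det_descFactorial_ne_zero hf) hc.symm

theorem theorem2 (p q : ℕ) (hp : 1 ≤ p) (hq : 1 ≤ q) :
    (∀ z : ℂ, ¬ ((hermiteWronskian (segmentS p q)).IsRoot z ∧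
        (hermiteWronskian (segmentS (p + 1) (q - 1))).IsRoot z)) ∧
    (∀ z : ℂ, (hermiteWronskian (segmentS p q)).IsRoot z →
        (hermiteWronskian (segmentS p q)).rootMultiplicity z = 1) ∧
    (∀ z : ℂ, ¬ ((hermiteWronskian (segmentS p q)).IsRoot z ∧
        (hermiteWronskian (segmentS (p + 1) q)).IsRoot z)) := by
  obtain ⟨n, rfl⟩ : ∃ n, q = n + 1 := ⟨q - 1, by omega⟩
  rw [Nat.add_sub_cancel]
  have hne : ∀ a b, hermiteWronskian (segmentS a b) ≠ 0 := fun a b => by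
    rw [hermiteWronskian_segmentS]
    exact hermiteDet_ne_zero fun i j h => Fin.ext (Nat.add_left_cancel h)
  -- The three sides of the triangle: deleting the least index of `S(p, n + 1)`, deleting the
  -- greatest of `S(p + 1, n + 1)`, and raising all of `S(p, n + 1)` by one.
  have hab : HirotaPair (hermiteWronskian (segmentS (p + 1) n))
      (hermiteWronskian (segmentS p (n + 1))) := by
    simp only [hermiteWronskian_segmentS]
    convert hirotaPair_hermiteDet_succAbove (fun i : Fin (n + 1) => p + i) 0 using 3
    simp
    omega
  have hac : HirotaPair (hermiteWronskian (segmentS (p + 1) n))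
      (hermiteWronskian (segmentS (p + 1) (n + 1))) := by
    simp only [hermiteWronskian_segmentS]
    convert hirotaPair_hermiteDet_succAbove (fun i : Fin (n + 1) => p + 1 + i) (Fin.last n) using 3
    simp
  have hcb : HirotaPair (hermiteWronskian (segmentS (p + 1) (n + 1)))
      (hermiteWronskian (segmentS p (n + 1))) := by
    simp only [hermiteWronskian_segmentS]
    convert hirotaPair_hermiteDet_add_one (fun i : Fin (n + 1) => p + i) using 3
    omega
  -- `Ω_{S(p, n + 1)}` takes the middle place, the one common to both disjunctions and bounded by
  -- one.
  have key := fun z => multiplicities_of_triangle (hab.rootMultiplicity_sq (hne _ _) (hne _ _) z)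
    (by
      linear_combination hcb.rootMultiplicity_sq (hne _ _) (hne _ _) z)
    (hac.rootMultiplicity_sq (hne _ _) (hne _ _) z)
  have hpos : ∀ a b z, (hermiteWronskian (segmentS a b)).IsRoot z →
      (hermiteWronskian (segmentS a b)).rootMultiplicity z ≠ 0 := fun a b z h =>
    ((rootMultiplicity_pos (hne a b)).mpr h).ne'
  refine ⟨fun z h => ?_, fun z h => ?_, fun z h => ?_⟩
  · exact (key z).1.elim (hpos _ _ z h.2) (hpos _ _ z h.1)
  · have := (key z).2.2
    have := hpos _ _ z h
    omega
  · exact (key z).2.1.elim (hpos _ _ z h.1) (hpos _ _ z h.2)
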